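/- \textbf{Theorem (minimax lower bound).} Let $K\ge 2$, $M\ge 1$ and $T$ be integers, and let $G$ be a directed graph on the action set $[K]=\{1,\dots,K\}$ that contains all self-loops; write $u\to v$ if $(u,v)$ is an edge. Consider the following stochastic contextual bandit with complete cross-learning. A context sequence $c^T=(c_1,\dots,c_T)\in[M]^T$ is fixed by an oblivious adversary. The reward tables $r_t=(r_{t,c,a})_{c\in[M],a\in[K]}\in[0,1]^{M\times K}$, $t=1,\dots,T$, are i.i.d. with an unknown law $P$, with means $\mu_{c,a}=\mathbb{E}_P[r_{t,c,a}]$. In round $t$ the learner sees $c_t$, chooses an action $a_t\in[K]$ (possibly at random) on the basis of $c_t$ and of the contexts, actions and observations of the earlier rounds, and then observes $r_{t,c,a}$ for all $c\in[M]$ and all $a$ with $a_t\to a$. For a set $\mathcal{C}\subseteq[M]^T$ of context sequences, the minimax regret is \[ \mathsf{R}_T^\star(G,M,\mathcal{C})=\inf_{\pi}\ \sup_{c^T\in\mathcal{C}}\ \sup_{P}\ \mathbb{E}\Big[\sum_{t=1}^T\Big(\max_{a\in[K]}\mu_{c_t,a}-\mu_{c_t,a_t}\Big)\Big], \] the infimum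 being over all policies of the learner, and $\mathsf{R}_T^\star(G,M)=\mathsf{R}_T^\star(G,M,[M]^T)$. Let \[ \beta_M(G)=\max\Big\{\sum_{c=1}^M|I_c| : I_1,\dots,I_M\subseteq[K],\ u\not\to v \text{ for distinct } u,v\in I_c,\ \text{and } u\not\to v \text{ for } u\in I_i,\ v\in I_j,\ i<j\Big\}. \] There is a universal constant $C>0$, independent of $K$, $M$, $T$ and $G$, such that whenever $T\ge\beta_M(G)^3$, \[ \mathsf{R}_T^\star(G,M)\ \ge\ C\sqrt{\beta_M(G)\,T}. \] Moreover, the same bound holds for $\mathsf{R}_T^\star(G,M,\mathcal{C})$ when $\mathcal{C}$ is the set of self-avoiding context sequences (those for which $c_s=c_t$ with $s<t$ implies $c_s=c_{s+1}=\dots=c_t$), and already when $\mathcal{C}$ is the set of sequences of the form $1\cdots12\cdots2\cdots M\cdots M$ (nondecreasing sequences; some contexts may not occur). -/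

import Mathlib

open MeasureTheory ProbabilityTheory

namespace GraphBandit

/-- A reward table: the reward in `[0,1]` of every action under every context, in one round. -/
abbrev Table (M K : ℕ) : Type := Fin M → Fin K → unitInterval

/-- The record of one round: the context, the action taken, and the observed feedback. -/
abbrev Round (M K : ℕ) : Type := Fin M × Fin K × Table M K

/-- The record of the first `t` rounds. -/
abbrev History (M K t : ℕ) : Type := Fin t → Round M K

open Classical in
/-- Feedback received when playing `a` in a round with reward table `r`: the rewards of all
out-neighbours of `a`, under all contexts (complete cross-learning). The entries that are not
observed are overwritten by `0`; as `a` is recorded and the graph is known, this carries exactly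
the information in the family of observed rewards. -/
noncomputable def feedback {M K : ℕ} (G : Digraph (Fin K)) (a : Fin K) (r : Table M K) :
    Table M K :=
  fun c b => if G.Adj a b then r c b else 0

/-- A (possibly randomized) admissible policy: in round `t` (counted from `0`), the distribution
of the action depends measurably on the record of the previous rounds and the current context. -/
structure Policy (M K : ℕ) where
  act : (t : ℕ) → Kernel (History M K t × Fin M) (Fin K)
  markov : ∀ t, IsMarkovKernel (act t)

/-- The law of the record of round `t`, with current context `c`, given the past: the action is
drawn from the policy, and the reward table is drawn from `P` independently of the past and of
the action. -/
noncomputable def roundKernel {M K : ℕ} (G : Digraph (Fin K)) (π : Policy M K)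
    (P : ProbabilityMeasure (Table M K)) (t : ℕ) (c : Fin M) :
    Kernel (History M K t) (Round M K) :=
  (((π.act t).comap (fun h => (h, c)) (by fun_prop)) ×ₖ
    (Kernel.const (History M K t) (P : Measure (Table M K)))).map
    (fun x => (c, x.1, feedback G x.1 x.2))

/-- The law of the record of `t` rounds under the policy `π`, the context sequence `c`, and
reward tables that are i.i.d. with law `P`. -/
noncomputable def historyLaw {M K : ℕ} (G : Digraph (Fin K)) (π : Policy M K)
    (P : ProbabilityMeasure (Table M K)) :
    (t : ℕ) → (Fin t → Fin M) → Measure (History M K t)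
  | 0, _ => Measure.dirac Fin.elim0
  | t + 1, c =>
      ((historyLaw G π P t (Fin.init c)) ⊗ₘ (roundKernel G π P t (c (Fin.last t)))).map
        (fun x => (Fin.snoc x.1 x.2 : History M K (t + 1)))

/-- The mean reward of action `a` under context `c`. -/
noncomputable def mean {M K : ℕ} (P : ProbabilityMeasure (Table M K)) (c : Fin M) (a : Fin K) :
    ℝ :=
  ∫ r, (r c a : ℝ) ∂(P : Measure (Table M K))

/-- The expected cumulative (pseudo-)regret over `T` rounds. -/
noncomputable def regret {M K : ℕ} (G : Digraph (Fin K)) (π : Policy M K)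
    (P : ProbabilityMeasure (Table M K)) {T : ℕ} (c : Fin T → Fin M) : ℝ :=
  ∫ h, ∑ t : Fin T, ((⨆ a : Fin K, mean P (c t) a) - mean P (c t) (h t).2.1)
    ∂(historyLaw G π P T c)

/-- The worst-case regret of a policy over the context sequences in `𝒞` and all stochastic
environments with rewards in `[0,1]`. -/
noncomputable def worstRegret {M K : ℕ} (G : Digraph (Fin K)) (π : Policy M K) {T : ℕ}
    (𝒞 : Set (Fin T → Fin M)) : EReal :=
  ⨆ c ∈ 𝒞, ⨆ P : ProbabilityMeasure (Table M K), (regret G π P c : EReal)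

/-- The minimax regret over the context sequences in `𝒞`. -/
noncomputable def minimaxRegret {M K : ℕ} (G : Digraph (Fin K)) {T : ℕ}
    (𝒞 : Set (Fin T → Fin M)) : EReal :=
  ⨅ π : Policy M K, worstRegret G π 𝒞

/-- Self-avoiding context sequences: contexts do not jump back. -/
def selfAvoiding (M T : ℕ) : Set (Fin T → Fin M) :=
  {c | ∀ s t : Fin T, s < t → c s = c t → ∀ i : Fin T, s ≤ i → i ≤ t → c i = c s}

/-- Context sequences of the form `1…12…2…M…M`, where blocks may be empty. -/
def orderedBlocks (M T : ℕ) : Set (Fin T → Fin M) :=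
  {c | Monotone c}

/-- A set of actions with no edge between two distinct members. -/
def IsIndependent {K : ℕ} (G : Digraph (Fin K)) (I : Finset (Fin K)) : Prop :=
  ∀ u ∈ I, ∀ v ∈ I, u ≠ v → ¬ G.Adj u v

/-- The maximum of `∑ |I_c|` over independent sets `I_1, …, I_M` with no edge from `I_i` to `I_j`
for `i < j`. -/
noncomputable def beta {K : ℕ} (G : Digraph (Fin K)) (M : ℕ) : ℕ :=
  sSup {n : ℕ | ∃ I : Fin M → Finset (Fin K),
    (∀ c, IsIndependent G (I c)) ∧
    (∀ i j, i < j → ∀ u ∈ I i, ∀ v ∈ I j, ¬ G.Adj u v) ∧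
    n = ∑ c, (I c).card}

end GraphBandit

/-! Fix a policy and sets `I c` attaining `beta G M` = β, and suppose first that β ≥ 2. An element
`u₀` of the first nonempty `I c` is the safe action, with mean 1/2 + Δ under every context. Let `S
c` be `I c` without `u₀`, so that the sizes of the `S c` add up to k = β - 1. Under context c, the
actions of `S c` have mean 1/2, except that at most one is raised to 1/2 + 2Δ; all remaining actions
have mean 0. Contexts come in increasing order, context c filling L |S c| rounds with L = ⌊T/k⌋.

By the conditions on the `I c`, until context c is over an action of `S c` can be observed in only
two ways: by playing it during context c, or by playing an action of mean 0. A policy with regret at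
most R does the latter at most 2R times in expectation. Averaged over `S c`, an action is thus
observed at most L + 2R times. With Δ of order 1/√L and R at most of order L, a raised mean then
remains unnoticed (`playProb_le_of_isTilt`), so that each round costs order Δ on average over the
instances (`hard_instance_bound`). In total R is at least of order L k Δ, that is k √L, or √(βT).
That R of this size is at most of order L means k² ≤ L, which is what T ≥ β³ provides.

For β = 1 there is nothing to remove from `I`, and the classical two-action argument under one
context suffices: no action is observed more than T times. -/

namespace GraphBandit

variable {M K : ℕ}

/-! ### Laws of records and expectations of sums over rounds -/

lemma measurable_feedback (G : Digraph (Fin K)) (a : Fin K) :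
    Measurable (feedback (M := M) G a) := by
  classical
  refine measurable_pi_iff.2 fun c => measurable_pi_iff.2 fun b => ?_
  unfold feedback
  by_cases h : G.Adj a b
  · simp only [h, if_true]; fun_prop
  · simp only [h, if_false]; fun_prop

lemma measurable_record (G : Digraph (Fin K)) (c : Fin M) :
    Measurable (fun x : Fin K × Table M K => ((c, x.1, feedback G x.1 x.2) : Round M K)) := by
  refine measurable_const.prodMk (measurable_fst.prodMk ?_)
  exact measurable_from_prod_countable_right fun a => measurable_feedback G a

lemma measurable_snoc (n : ℕ) :
    Measurable (fun x : History M K n × Round M K => (Fin.snoc x.1 x.2 : History M K (n + 1))) := by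
  refine measurable_pi_iff.2 fun i => ?_
  refine Fin.lastCases ?_ (fun j => ?_) i
  · simpa using measurable_snd
  · simp only [Fin.snoc_castSucc]; fun_prop

instance (π : Policy M K) (t : ℕ) : IsMarkovKernel (π.act t) := π.markov t

instance isMarkovKernel_roundKernel (G : Digraph (Fin K)) (π : Policy M K)
    (P : ProbabilityMeasure (Table M K)) (t : ℕ) (c : Fin M) :
    IsMarkovKernel (roundKernel G π P t c) := by
  unfold roundKernel
  exact Kernel.IsMarkovKernel.map _ (measurable_record G c)

instance isProbabilityMeasure_historyLaw (G : Digraph (Fin K)) (π : Policy M K)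
    (P : ProbabilityMeasure (Table M K)) (t : ℕ) (c : Fin t → Fin M) :
    IsProbabilityMeasure (historyLaw G π P t c) := by
  induction t with
  | zero => unfold historyLaw; infer_instance
  | succ t ih =>
    unfold historyLaw
    have := ih (Fin.init c)
    exact Measure.isProbabilityMeasure_map (measurable_snoc t).aemeasurable

/-- The law of the record of `t` rounds along an infinite context sequence. -/
noncomputable def law (G : Digraph (Fin K)) (π : Policy M K)
    (P : ProbabilityMeasure (Table M K)) (c : ℕ → Fin M) (t : ℕ) : Measure (History M K t) :=
  historyLaw G π P t (fun i => c i)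

instance (G : Digraph (Fin K)) (π : Policy M K)
    (P : ProbabilityMeasure (Table M K)) (c : ℕ → Fin M) (t : ℕ) :
    IsProbabilityMeasure (law G π P c t) := by unfold law; infer_instance

lemma law_succ (G : Digraph (Fin K)) (π : Policy M K)
    (P : ProbabilityMeasure (Table M K)) (c : ℕ → Fin M) (t : ℕ) :
    law G π P c (t + 1) = ((law G π P c t) ⊗ₘ (roundKernel G π P t (c t))).map
        (fun x => (Fin.snoc x.1 x.2 : History M K (t + 1))) := rfl

/-- The probability that action `b` is played in round `t`. -/
noncomputable def playProb (G : Digraph (Fin K)) (π : Policy M K)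
    (P : ProbabilityMeasure (Table M K)) (c : ℕ → Fin M) (t : ℕ) (b : Fin K) : ℝ :=
  ∫ h, (π.act t (h, c t)).real {b} ∂(law G π P c t)

lemma measurable_act_real (π : Policy M K) (t : ℕ) (c : Fin M) (b : Fin K) :
    Measurable (fun h : History M K t => (π.act t (h, c)).real {b}) := by
  have : Measurable (fun h : History M K t => (π.act t (h, c)) {b}) :=
    ((π.act t).measurable_coe (measurableSet_singleton b)).comp (by fun_prop)
  exact this.ennreal_toReal

lemma integrable_act_real (π : Policy M K) (t : ℕ) (c : Fin M) (b : Fin K)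
    (μ : Measure (History M K t)) [IsFiniteMeasure μ] :
    Integrable (fun h : History M K t => (π.act t (h, c)).real {b}) μ :=
  Integrable.of_bound (measurable_act_real π t c b).aestronglyMeasurable 1
    (Filter.Eventually.of_forall fun h => by
      rw [Real.norm_of_nonneg measureReal_nonneg]; exact measureReal_le_one)

lemma playProb_nonneg (G : Digraph (Fin K)) (π : Policy M K)
    (P : ProbabilityMeasure (Table M K)) (c : ℕ → Fin M) (t : ℕ) (b : Fin K) :
    0 ≤ playProb G π P c t b :=
  integral_nonneg fun _ => measureReal_nonneg

lemma sum_playProb (G : Digraph (Fin K)) (π : Policy M K)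
    (P : ProbabilityMeasure (Table M K)) (c : ℕ → Fin M) (t : ℕ) :
    ∑ b, playProb G π P c t b = 1 := by
  unfold playProb
  rw [← integral_finsetSum _ (fun b _ => integrable_act_real π t (c t) b _)]
  have : ∀ h, ∑ b, (π.act t (h, c t)).real {b} = 1 := fun h => by
    rw [sum_measureReal_singleton]; simp
  simp [this]

lemma lintegral_roundKernel (G : Digraph (Fin K)) (π : Policy M K)
    (P : ProbabilityMeasure (Table M K)) (t : ℕ) (c : Fin M) (h : History M K t)
    {f : Round M K → ENNReal} (hf : Measurable f) :
    ∫⁻ x, f x ∂(roundKernel G π P t c h) =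
      ∑ b, (π.act t (h, c)) {b} *
        ∫⁻ r, f (c, b, feedback G b r) ∂(P : Measure (Table M K)) := by
  unfold roundKernel
  rw [Kernel.map_apply _ (measurable_record G c), lintegral_map hf (measurable_record G c),
    Kernel.prod_apply, Kernel.const_apply, Kernel.comap_apply]
  refine (lintegral_prod _ (hf.comp (measurable_record G c)).aemeasurable).trans ?_
  rw [lintegral_fintype]
  exact Finset.sum_congr rfl fun b _ => mul_comm _ _

lemma integral_roundKernel (G : Digraph (Fin K)) (π : Policy M K)
    (P : ProbabilityMeasure (Table M K)) (t : ℕ) (c : Fin M) (h : History M K t)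
    {f : Round M K → ℝ} (hf : Measurable f) {B : ℝ} (hB : ∀ x, |f x| ≤ B) :
    ∫ x, f x ∂(roundKernel G π P t c h) =
      ∑ b, (π.act t (h, c)).real {b} *
        ∫ r, f (c, b, feedback G b r) ∂(P : Measure (Table M K)) := by
  unfold roundKernel
  have hm := hf.comp (measurable_record G c)
  rw [Kernel.map_apply _ (measurable_record G c),
    integral_map (measurable_record G c).aemeasurable hf.aestronglyMeasurable,
    Kernel.prod_apply, Kernel.const_apply, Kernel.comap_apply, integral_prod,
    integral_fintype]
  · rfl
  · exact Integrable.of_finite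
  · exact Integrable.of_bound hm.aestronglyMeasurable B (Filter.Eventually.of_forall fun _ => hB _)

/-- The expectation of an additive functional of the record. -/
lemma integral_sum_law (G : Digraph (Fin K)) (π : Policy M K)
    (P : ProbabilityMeasure (Table M K)) (c : ℕ → Fin M) (g : ℕ → Round M K → ℝ)
    (hg : ∀ t, Measurable (g t)) {B : ℝ} (hB : ∀ t x, |g t x| ≤ B) (n : ℕ) :
    ∫ h, ∑ t : Fin n, g t (h t) ∂(law G π P c n) =
      ∑ t ∈ Finset.range n, ∑ b, playProb G π P c t b *
        ∫ r, g t (c t, b, feedback G b r) ∂(P : Measure (Table M K)) := by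
  induction n with
  | zero => simp
  | succ n ih =>
    have hint : ∀ (m : ℕ) (μ : Measure (History M K m)) [IsFiniteMeasure μ],
        Integrable (fun h : History M K m => ∑ t : Fin m, g t (h t)) μ := fun m μ _ =>
      integrable_finsetSum _ fun t _ => Integrable.of_bound
        ((hg t).comp (measurable_pi_apply t)).aestronglyMeasurable B
        (Filter.Eventually.of_forall fun _ => hB _ _)
    rw [Finset.sum_range_succ, ← ih, law_succ,
      integral_map (measurable_snoc n).aemeasurable (hint _ _).aestronglyMeasurable]
    simp only [Fin.sum_univ_castSucc, Fin.snoc_castSucc, Fin.snoc_last, Fin.val_castSucc,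
      Fin.val_last]
    have h1 : Integrable (fun x : History M K n × Round M K => ∑ t : Fin n, g t (x.1 t))
        (law G π P c n ⊗ₘ roundKernel G π P n (c n)) :=
      integrable_finsetSum _ fun t _ => Integrable.of_bound
        ((hg t).comp ((measurable_pi_apply t).comp measurable_fst)).aestronglyMeasurable B
        (Filter.Eventually.of_forall fun _ => hB _ _)
    have h2 : Integrable (fun x : History M K n × Round M K => g n x.2)
        (law G π P c n ⊗ₘ roundKernel G π P n (c n)) :=
      Integrable.of_bound ((hg n).comp measurable_snd).aestronglyMeasurable B
        (Filter.Eventually.of_forall fun _ => hB _ _)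
    rw [integral_add h1 h2, Measure.integral_compProd h1, Measure.integral_compProd h2]
    congr 1
    · simp
    · simp only [integral_roundKernel G π P n (c n) _ (hg n) (hB n)]
      rw [integral_finsetSum _ fun b _ => (integrable_act_real π n (c n) b _).mul_const _]
      simp only [integral_mul_const, playProb]

/-- From here on a policy enters only through its play probabilities. -/
lemma regret_eq (G : Digraph (Fin K)) (π : Policy M K)
    (P : ProbabilityMeasure (Table M K)) (c : ℕ → Fin M) (T : ℕ) :
    regret G π P (fun t : Fin T => c t) =
      ∑ t ∈ Finset.range T, ∑ b, playProb G π P c t b *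
        ((⨆ a : Fin K, mean P (c t) a) - mean P (c t) b) := by
  have := integral_sum_law G π P c
    (fun t x => (⨆ a : Fin K, mean P (c t) a) - mean P (c t) x.2.1)
    (fun t => by
      have : Measurable (fun b : Fin K => (⨆ a : Fin K, mean P (c t) a) - mean P (c t) b) :=
        measurable_of_countable _
      exact this.comp (by fun_prop))
    -- Summing over all contexts and actions gives a crude bound that is uniform in the round.
    (B := ∑ i : Fin M, ∑ b, |(⨆ a : Fin K, mean P i a) - mean P i b|)
    (fun t x => by
      refine le_trans ?_ (Finset.single_le_sum (f := fun i : Fin M =>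
        ∑ b, |(⨆ a : Fin K, mean P i a) - mean P i b|)
        (fun i _ => Finset.sum_nonneg fun b _ => abs_nonneg _) (Finset.mem_univ (c t)))
      exact Finset.single_le_sum (f := fun b => |(⨆ a : Fin K, mean P (c t) a) - mean P (c t) b|)
        (fun b _ => abs_nonneg _) (Finset.mem_univ x.2.1)) T
  simp only [integral_const, probReal_univ, one_smul] at this
  exact this

/-! ### Tilting one entry of the reward table -/

/-- Reflect the reward of action `a₀` under context `c₀` about `1/2`. -/
def flip (c₀ : Fin M) (a₀ : Fin K) (r : Table M K) : Table M K :=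
  fun c b => if c = c₀ ∧ b = a₀ then unitInterval.symm (r c b) else r c b

lemma measurable_flip (c₀ : Fin M) (a₀ : Fin K) : Measurable (flip c₀ a₀) := by
  refine measurable_pi_iff.2 fun c => measurable_pi_iff.2 fun b => ?_
  unfold flip
  split_ifs
  · exact unitInterval.continuous_symm.measurable.comp (by fun_prop)
  · fun_prop

/-- The density of a tilt by `δ` of the reward of `a₀` under `c₀`. -/
def tilt (δ : ℝ) (c₀ : Fin M) (a₀ : Fin K) (r : Table M K) : ℝ := 1 + δ * (2 * (r c₀ a₀ : ℝ) - 1)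

lemma measurable_tilt (δ : ℝ) (c₀ : Fin M) (a₀ : Fin K) :
    Measurable (tilt δ c₀ a₀) := by
  unfold tilt; fun_prop

lemma tilt_mem (δ : ℝ) (hδ : 0 ≤ δ) (c₀ : Fin M) (a₀ : Fin K) (r : Table M K) :
    1 - δ ≤ tilt δ c₀ a₀ r ∧ tilt δ c₀ a₀ r ≤ 1 + δ := by
  have h0 := (r c₀ a₀).2.1
  have h1 := (r c₀ a₀).2.2
  unfold tilt
  constructor <;> nlinarith

lemma tilt_flip (δ : ℝ) (c₀ : Fin M) (a₀ : Fin K) (r : Table M K) :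
    tilt δ c₀ a₀ (flip c₀ a₀ r) = 2 - tilt δ c₀ a₀ r := by
  simp [tilt, flip]; ring

/-- `Q` arises from `P` by tilting the reward of `a₀` under `c₀`, which is symmetric under `P`. -/
structure IsTilt (P Q : ProbabilityMeasure (Table M K)) (δ : ℝ) (c₀ : Fin M) (a₀ : Fin K) :
    Prop where
  symm : (P : Measure (Table M K)).map (flip c₀ a₀) = P
  density : (Q : Measure (Table M K)) =
    (P : Measure (Table M K)).withDensity (fun r => ENNReal.ofReal (tilt δ c₀ a₀ r))

open Classical in
/-- The likelihood ratio of one round. -/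
noncomputable def roundRatio (G : Digraph (Fin K)) (δ : ℝ) (c₀ : Fin M) (a₀ : Fin K)
    (x : Round M K) : ℝ :=
  if G.Adj x.2.1 a₀ then tilt δ c₀ a₀ x.2.2 else 1

lemma measurable_roundRatio (G : Digraph (Fin K)) (δ : ℝ) (c₀ : Fin M) (a₀ : Fin K) :
    Measurable (roundRatio G δ c₀ a₀) := by
  unfold roundRatio
  refine Measurable.ite ?_ ((measurable_tilt δ c₀ a₀).comp (by fun_prop)) measurable_const
  exact (measurable_snd.fst : Measurable fun x : Round M K => x.2.1)
    (Set.to_countable {b | G.Adj b a₀}).measurableSet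

lemma roundRatio_mem (G : Digraph (Fin K)) (δ : ℝ) (hδ : 0 ≤ δ) (c₀ : Fin M) (a₀ : Fin K)
    (x : Round M K) : 1 - δ ≤ roundRatio G δ c₀ a₀ x ∧ roundRatio G δ c₀ a₀ x ≤ 1 + δ := by
  unfold roundRatio
  split_ifs
  · exact tilt_mem δ hδ _ _ _
  · constructor <;> linarith

/-- If `b` reveals `a₀`, the tilt is a function of the feedback. Otherwise the feedback is invariant
under `flip`, while `flip` exchanges the densities `tilt` and `2 - tilt`; both integrals agree and
their average is the untilted one, so the tilt is invisible. -/
lemma lintegral_feedback_of_isTilt (G : Digraph (Fin K)) {P Q : ProbabilityMeasure (Table M K)}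
    {δ : ℝ} (hδ0 : 0 ≤ δ) (hδ : δ < 1) {c₀ : Fin M} {a₀ : Fin K} (h : IsTilt P Q δ c₀ a₀)
    (c : Fin M) (b : Fin K) {f : Round M K → ENNReal} (hf : Measurable f) :
    ∫⁻ r, f (c, b, feedback G b r) ∂(Q : Measure (Table M K)) =
      ∫⁻ r, (fun x => ENNReal.ofReal (roundRatio G δ c₀ a₀ x) * f x) (c, b, feedback G b r)
        ∂(P : Measure (Table M K)) := by
  classical
  have hm : Measurable fun r => f (c, b, feedback G b r) :=
    hf.comp (measurable_const.prodMk (measurable_const.prodMk (measurable_feedback G b)))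
  have ht : Measurable fun r => ENNReal.ofReal (tilt δ c₀ a₀ r) :=
    (measurable_tilt δ c₀ a₀).ennreal_ofReal
  rw [h.density, lintegral_withDensity_eq_lintegral_mul _ ht hm]
  by_cases hb : G.Adj b a₀
  · refine lintegral_congr fun r => ?_
    simp [roundRatio, hb, tilt, feedback]
  · simp only [roundRatio, hb, if_false, ENNReal.ofReal_one, one_mul, Pi.mul_apply]
    have hinv : ∀ r, feedback G b (flip c₀ a₀ r) = feedback G b r := fun r => by
      funext i j
      unfold feedback flip
      by_cases hj : j = a₀
      · subst hj; simp [hb]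
      · simp [hj]
    have htm : Measurable fun r => ENNReal.ofReal (tilt δ c₀ a₀ r) * f (c, b, feedback G b r) :=
      ht.mul hm
    have e : ∫⁻ r, ENNReal.ofReal (tilt δ c₀ a₀ r) * f (c, b, feedback G b r)
          ∂(P : Measure (Table M K)) =
        ∫⁻ r, ENNReal.ofReal (2 - tilt δ c₀ a₀ r) * f (c, b, feedback G b r)
          ∂(P : Measure (Table M K)) := by
      conv_lhs => rw [← h.symm]
      rw [lintegral_map htm (measurable_flip c₀ a₀)]
      simp only [tilt_flip, hinv]
    have e2 : ∫⁻ r, ENNReal.ofReal (tilt δ c₀ a₀ r) * f (c, b, feedback G b r)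
          ∂(P : Measure (Table M K)) +
        ∫⁻ r, ENNReal.ofReal (2 - tilt δ c₀ a₀ r) * f (c, b, feedback G b r)
          ∂(P : Measure (Table M K)) =
        2 * ∫⁻ r, f (c, b, feedback G b r) ∂(P : Measure (Table M K)) := by
      rw [← lintegral_add_left htm, ← lintegral_const_mul _ hm]
      refine lintegral_congr fun r => ?_
      have := tilt_mem δ hδ0 c₀ a₀ r
      rw [← add_mul, ← ENNReal.ofReal_add (by linarith) (by linarith)]
      norm_num
    rw [← e, ← two_mul] at e2
    exact (ENNReal.mul_right_inj (by simp) (by simp)).1 e2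

/-- The likelihood ratio of a record. -/
noncomputable def ratio (G : Digraph (Fin K)) (δ : ℝ) (c₀ : Fin M) (a₀ : Fin K) {n : ℕ}
    (h : History M K n) : ℝ := ∏ t, roundRatio G δ c₀ a₀ (h t)

lemma measurable_ratio (G : Digraph (Fin K)) (δ : ℝ) (c₀ : Fin M) (a₀ : Fin K) (n : ℕ) :
    Measurable (ratio G δ c₀ a₀ (n := n)) :=
  Finset.measurable_fun_prod _ fun t _ =>
    (measurable_roundRatio G δ c₀ a₀).comp (measurable_pi_apply t)

/-- The policy acts in the same way under `P` and `Q`, so its probabilities cancel and the one-round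
ratios multiply. -/
lemma law_eq_withDensity (G : Digraph (Fin K)) (π : Policy M K)
    {P Q : ProbabilityMeasure (Table M K)} {δ : ℝ} (hδ0 : 0 ≤ δ) (hδ : δ < 1) {c₀ : Fin M}
    {a₀ : Fin K} (h : IsTilt P Q δ c₀ a₀) (c : ℕ → Fin M) (n : ℕ) :
    law G π Q c n = (law G π P c n).withDensity
      (fun h => ENNReal.ofReal (ratio G δ c₀ a₀ h)) := by
  induction n with
  | zero =>
    simp only [ratio, Finset.univ_eq_empty, Finset.prod_empty, ENNReal.ofReal_one]
    exact withDensity_one.symm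
  | succ n ih =>
    have hmeas := fun m => (measurable_ratio G δ c₀ a₀ m).ennreal_ofReal
    refine Measure.ext_of_lintegral _ fun f hf => ?_
    have hr := (measurable_roundRatio G δ c₀ a₀).ennreal_ofReal
    have hfs : Measurable fun x : History M K n × Round M K => f (Fin.snoc x.1 x.2) :=
      hf.comp (measurable_snoc n)
    have hrfs : Measurable fun x : History M K n × Round M K =>
        ((fun h : History M K (n + 1) => ENNReal.ofReal (ratio G δ c₀ a₀ h)) * f)
          (Fin.snoc x.1 x.2) :=
      ((hmeas _).mul hf).comp (measurable_snoc n)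
    rw [lintegral_withDensity_eq_lintegral_mul _ (hmeas _) hf, law_succ, law_succ,
      lintegral_map hf (measurable_snoc n), lintegral_map ((hmeas _).mul hf) (measurable_snoc n),
      Measure.lintegral_compProd hfs, Measure.lintegral_compProd hrfs, ih,
      lintegral_withDensity_eq_lintegral_mul _ (hmeas _) hfs.lintegral_kernel_prod_right']
    refine lintegral_congr fun y => ?_
    have hfy : Measurable fun x : Round M K => f (Fin.snoc y x) :=
      hf.comp ((measurable_snoc n).comp (measurable_const.prodMk measurable_id))
    have hrfy : Measurable fun x : Round M K =>
        ENNReal.ofReal (roundRatio G δ c₀ a₀ x) * f (Fin.snoc y x) := hr.mul hfy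
    have hF : ∀ x : Round M K, ENNReal.ofReal (ratio G δ c₀ a₀
          (Fin.snoc y x : History M K (n + 1))) * f (Fin.snoc y x) =
        ENNReal.ofReal (ratio G δ c₀ a₀ y) *
          (ENNReal.ofReal (roundRatio G δ c₀ a₀ x) * f (Fin.snoc y x)) := fun x => by
      unfold ratio
      rw [Fin.prod_univ_castSucc, ENNReal.ofReal_mul, mul_assoc]
      · simp only [Fin.snoc_castSucc, Fin.snoc_last]
      · exact Finset.prod_nonneg fun t _ => by
          linarith [(roundRatio_mem G δ hδ0 c₀ a₀
            ((Fin.snoc y x : History M K (n + 1)) t.castSucc)).1]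
    simp only [Pi.mul_apply, hF]
    rw [lintegral_const_mul _ hrfy, lintegral_roundKernel G π Q n (c n) y hfy,
      lintegral_roundKernel G π P n (c n) y hrfy]
    congr 1
    refine Finset.sum_congr rfl fun b _ => ?_
    rw [lintegral_feedback_of_isTilt G hδ0 hδ h (c n) b hfy]

/-! ### Information cost of a tilt and change of measure -/

lemma abs_neg_log_le {δ y : ℝ} (hδ : δ < 1) (h1 : 1 - δ ≤ y) (h2 : y ≤ 1 + δ) :
    |-Real.log y| ≤ 1 / (1 - δ) := by
  have hy : 0 < y := by linarith
  rw [abs_neg, abs_le]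
  constructor
  · have := Real.one_sub_inv_le_log_of_pos hy
    have h3 : y⁻¹ ≤ 1 / (1 - δ) := by
      rw [inv_eq_one_div]; exact one_div_le_one_div_of_le (by linarith) h1
    linarith
  · have := Real.log_le_sub_one_of_pos hy
    have h3 : 1 + δ ≤ 1 / (1 - δ) := by
      rw [le_div_iff₀ (by linarith)]; nlinarith [sq_nonneg δ]
    linarith

/-- Averaging with the reflected table cancels the term linear in δ: with y the tilt, log y + log (2
- y) = log (1 - (y - 1)²), and |y - 1| ≤ δ. -/
lemma integral_log_tilt {P Q : ProbabilityMeasure (Table M K)}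
    {δ : ℝ} (hδ0 : 0 ≤ δ) (hδ : δ ^ 2 ≤ 1 / 2) {c₀ : Fin M} {a₀ : Fin K}
    (h : IsTilt P Q δ c₀ a₀) :
    ∫ r, -Real.log (tilt δ c₀ a₀ r) ∂(P : Measure (Table M K)) ≤ δ ^ 2 := by
  have hδ1 : δ < 1 := by nlinarith
  have hl : Measurable fun r => -Real.log (tilt δ c₀ a₀ r) :=
    (Real.measurable_log.comp (measurable_tilt δ c₀ a₀)).neg
  have hl2 : Measurable fun r => -Real.log (2 - tilt δ c₀ a₀ r) :=
    (Real.measurable_log.comp ((measurable_tilt δ c₀ a₀).const_sub 2)).neg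
  have i1 : Integrable (fun r => -Real.log (tilt δ c₀ a₀ r)) (P : Measure (Table M K)) :=
    Integrable.of_bound hl.aestronglyMeasurable _ (Filter.Eventually.of_forall fun r =>
      abs_neg_log_le hδ1 (tilt_mem δ hδ0 c₀ a₀ r).1 (tilt_mem δ hδ0 c₀ a₀ r).2)
  have i2 : Integrable (fun r => -Real.log (2 - tilt δ c₀ a₀ r)) (P : Measure (Table M K)) :=
    Integrable.of_bound hl2.aestronglyMeasurable _ (Filter.Eventually.of_forall fun r =>
      abs_neg_log_le hδ1 (by linarith [(tilt_mem δ hδ0 c₀ a₀ r).2]) (by linarith [(tilt_mem δ hδ0 c₀ a₀ r).1]))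
  have e : ∫ r, -Real.log (tilt δ c₀ a₀ r) ∂(P : Measure (Table M K)) =
      ∫ r, -Real.log (2 - tilt δ c₀ a₀ r) ∂(P : Measure (Table M K)) := by
    conv_lhs => rw [← h.symm]
    rw [integral_map (measurable_flip c₀ a₀).aemeasurable hl.aestronglyMeasurable]
    simp only [tilt_flip]
  have e2 : ∫ r, (-Real.log (tilt δ c₀ a₀ r) + -Real.log (2 - tilt δ c₀ a₀ r))
      ∂(P : Measure (Table M K)) ≤ ∫ r, 2 * δ ^ 2 ∂(P : Measure (Table M K)) := by
    refine integral_mono (i1.add i2) (integrable_const _) fun r => ?_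
    obtain ⟨h1, h2⟩ := tilt_mem δ hδ0 c₀ a₀ r
    simp only
    set y := tilt δ c₀ a₀ r
    have hp : 0 < y * (2 - y) := mul_pos (by linarith) (by linarith)
    have h3 := Real.one_sub_inv_le_log_of_pos hp
    rw [Real.log_mul (by linarith) (by linarith)] at h3
    have h5 : 1 - δ ^ 2 ≤ y * (2 - y) := by nlinarith
    -- Amounts to (1 - δ²)(1 + 2δ²) ≥ 1, that is δ² ≤ 1/2.
    have h4 : (y * (2 - y))⁻¹ ≤ 1 + 2 * δ ^ 2 := by
      rw [inv_le_comm₀ hp (by positivity)]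
      refine le_trans ?_ h5
      rw [inv_le_iff_one_le_mul₀ (by positivity)]
      nlinarith [sq_nonneg δ]
    linarith
  rw [integral_add i1 i2, ← e] at e2
  simp at e2
  linarith

-- Chain rule for relative entropy: only rounds whose action reveals `a₀` contribute, each at most
-- δ².
open Classical in
lemma integral_log_ratio (G : Digraph (Fin K)) (π : Policy M K)
    {P Q : ProbabilityMeasure (Table M K)} {δ : ℝ} (hδ0 : 0 ≤ δ) (hδ : δ ^ 2 ≤ 1 / 2)
    {c₀ : Fin M} {a₀ : Fin K} (h : IsTilt P Q δ c₀ a₀) (c : ℕ → Fin M) (n : ℕ) :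
    Integrable (fun h => -Real.log (ratio G δ c₀ a₀ h)) (law G π P c n) ∧
    ∫ h, -Real.log (ratio G δ c₀ a₀ h) ∂(law G π P c n) ≤
      δ ^ 2 * ∑ s ∈ Finset.range n, ∑ b, if G.Adj b a₀ then playProb G π P c s b else 0 := by
  have hδ1 : δ < 1 := by nlinarith
  have hbd : ∀ x, |-Real.log (roundRatio G δ c₀ a₀ x)| ≤ 1 / (1 - δ) := fun x =>
    abs_neg_log_le hδ1 (roundRatio_mem G δ hδ0 c₀ a₀ x).1 (roundRatio_mem G δ hδ0 c₀ a₀ x).2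
  have hm : Measurable fun x => -Real.log (roundRatio G δ c₀ a₀ x) :=
    (Real.measurable_log.comp (measurable_roundRatio G δ c₀ a₀)).neg
  have hfun : (fun h : History M K n => -Real.log (ratio G δ c₀ a₀ h)) =
      fun h => ∑ t : Fin n, -Real.log (roundRatio G δ c₀ a₀ (h t)) := by
    funext h
    unfold ratio
    rw [Real.log_prod, Finset.sum_neg_distrib]
    intro t _
    have := (roundRatio_mem G δ hδ0 c₀ a₀ (h t)).1
    linarith
  rw [hfun]
  refine ⟨integrable_finsetSum _ fun t _ => Integrable.of_bound
        (hm.comp (measurable_pi_apply t)).aestronglyMeasurable _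
        (Filter.Eventually.of_forall fun _ => hbd _), ?_⟩
  rw [integral_sum_law G π P c (fun _ x => -Real.log (roundRatio G δ c₀ a₀ x)) (fun _ => hm)
    (fun _ => hbd) n, Finset.mul_sum]
  refine Finset.sum_le_sum fun s _ => ?_
  rw [Finset.mul_sum]
  refine Finset.sum_le_sum fun b _ => ?_
  by_cases hb : G.Adj b a₀
  · have := integral_log_tilt hδ0 hδ h
    have e : ∀ r, tilt δ c₀ a₀ (feedback G b r) = tilt δ c₀ a₀ r := fun r => by
      simp [tilt, feedback, hb]
    simp only [roundRatio, hb, if_true, e]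
    rw [mul_comm]
    exact mul_le_mul_of_nonneg_right this (playProb_nonneg _ _ _ _ _ _)
  · simp [roundRatio, hb]

/-- Tangent line of log at 4/5. It replaces Pinsker's inequality by a bound linear in the relative
entropy, which can be averaged over actions without a square root. -/
lemma one_sub_le_of_pos {x : ℝ} (hx : 0 < x) : 1 - x ≤ 1 / 5 + 4 * (x - 1 - Real.log x) := by
  have h1 := Real.log_le_sub_one_of_pos (show (0 : ℝ) < 5 / 4 * x by linarith)
  rw [Real.log_mul (by norm_num) hx.ne'] at h1
  have h2 := Real.one_sub_inv_le_log_of_pos (show (0 : ℝ) < 5 / 4 by norm_num)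
  norm_num at h2
  linarith

open Classical in
/-- A tilt cannot be noticed before the tilted entry has been observed often. -/
theorem playProb_le_of_isTilt (G : Digraph (Fin K)) (π : Policy M K)
    {P Q : ProbabilityMeasure (Table M K)} {δ : ℝ} (hδ0 : 0 ≤ δ) (hδ : δ ^ 2 ≤ 1 / 2)
    {c₀ : Fin M} {a₀ : Fin K} (h : IsTilt P Q δ c₀ a₀) (c : ℕ → Fin M) (t : ℕ) (b : Fin K) :
    playProb G π Q c t b ≤ playProb G π P c t b + 1 / 5 + 4 * (δ ^ 2 *
      ∑ s ∈ Finset.range t, ∑ b', if G.Adj b' a₀ then playProb G π P c s b' else 0) := by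
  have hδ1 : δ < 1 := by nlinarith
  obtain ⟨hli, hl⟩ := integral_log_ratio G π hδ0 hδ h c t
  have hpos : ∀ y : History M K t, 0 < ratio G δ c₀ a₀ y := fun y =>
    Finset.prod_pos fun i _ => by linarith [(roundRatio_mem G δ hδ0 c₀ a₀ (y i)).1]
  have hm := measurable_ratio (M := M) G δ c₀ a₀ t
  have hQ : ∀ F : History M K t → ℝ, ∫ y, F y ∂(law G π Q c t) =
      ∫ y, ratio G δ c₀ a₀ y * F y ∂(law G π P c t) := fun F => by
    rw [law_eq_withDensity G π hδ0 hδ1 h, integral_withDensity_eq_integral_toReal_smul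
      hm.ennreal_ofReal (Filter.Eventually.of_forall fun _ => ENNReal.ofReal_lt_top)]
    simp only [ENNReal.toReal_ofReal (hpos _).le, smul_eq_mul]
  have hri : Integrable (ratio G δ c₀ a₀) (law G π P c t) := by
    refine Integrable.of_bound hm.aestronglyMeasurable ((1 + δ) ^ t)
      (Filter.Eventually.of_forall fun y => ?_)
    rw [Real.norm_of_nonneg (hpos y).le]
    unfold ratio
    calc _ ≤ ∏ i : Fin t, (1 + δ) := Finset.prod_le_prod
          (fun i _ => by linarith [(roundRatio_mem G δ hδ0 c₀ a₀ (y i)).1])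
          (fun i _ => (roundRatio_mem G δ hδ0 c₀ a₀ (y i)).2)
      _ = _ := by simp
  have h1 : ∫ y, ratio G δ c₀ a₀ y ∂(law G π P c t) = 1 := by
    have := hQ fun _ => 1
    simp only [integral_const, probReal_univ, smul_eq_mul, mul_one] at this
    exact this.symm
  have hact := integrable_act_real π t (c t) b (law G π P c t)
  have hle : ∀ y, (π.act t (y, c t)).real {b} ≤ 1 := fun y => measureReal_le_one
  have hge : ∀ y, 0 ≤ (π.act t (y, c t)).real {b} := fun y => measureReal_nonneg
  have hract : Integrable (fun y => ratio G δ c₀ a₀ y * (π.act t (y, c t)).real {b})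
      (law G π P c t) := by
    refine hri.mul_bdd (c := 1) (measurable_act_real π t (c t) b).aestronglyMeasurable
      (Filter.Eventually.of_forall fun y => ?_)
    rw [Real.norm_of_nonneg (hge y)]; exact hle y
  have i1 : Integrable (fun y => 4 * (-Real.log (ratio G δ c₀ a₀ y))) (law G π P c t) :=
    hli.const_mul 4
  have i2 : Integrable (fun y => 5 * ratio G δ c₀ a₀ y - 24 / 5) (law G π P c t) :=
    (hri.const_mul 5).sub (integrable_const _)
  have i3 : Integrable (fun y => 4 * (-Real.log (ratio G δ c₀ a₀ y)) +
      (5 * ratio G δ c₀ a₀ y - 24 / 5)) (law G π P c t) := i1.add i2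
  -- With Λ the ratio and q ∈ [0,1] the play probability, (Λ - 1) q ≤ (Λ - 1) + (1 - Λ)⁺. Bounding
  -- the positive part by `one_sub_le_of_pos` gives 5Λ - 24/5 - 4 log Λ, and Λ has mean 1.
  have key : ∫ y, ratio G δ c₀ a₀ y * (π.act t (y, c t)).real {b} ∂(law G π P c t) ≤
      ∫ y, ((π.act t (y, c t)).real {b} + (4 * (-Real.log (ratio G δ c₀ a₀ y)) +
        (5 * ratio G δ c₀ a₀ y - 24 / 5))) ∂(law G π P c t) := by
    refine integral_mono hract (hact.add (i1.add i2)) fun y => ?_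
    have h2 := one_sub_le_of_pos (hpos y)
    have h3 := Real.log_le_sub_one_of_pos (hpos y)
    simp only
    nlinarith [hle y, hge y]
  rw [integral_add hact i3, integral_add i1 i2, integral_sub (hri.const_mul 5)
    (integrable_const _), integral_const_mul, integral_const_mul, h1, integral_const, probReal_univ, one_smul] at key
  have hQb : playProb G π Q c t b = _ := hQ fun y => (π.act t (y, c t)).real {b}
  have hPb : playProb G π P c t b =
      ∫ y, (π.act t (y, c t)).real {b} ∂(law G π P c t) := rfl
  rw [hQb, hPb]
  linarith

/-! ### Tables with independent Bernoulli entries -/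

/-- The probability of a binary table under independent Bernoulli entries with means `m`. -/
noncomputable def bernoulliWeight (m : Fin M → Fin K → ℝ) (x : Fin M × Fin K → Bool) : ℝ :=
  ∏ p, if x p then m p.1 p.2 else 1 - m p.1 p.2

/-- A binary table, as a reward table. -/
def binaryTable (x : Fin M × Fin K → Bool) : Table M K := fun c a => if x (c, a) then 1 else 0

lemma bernoulliWeight_nonneg {m : Fin M → Fin K → ℝ} (hm : ∀ c a, m c a ∈ Set.Icc (0 : ℝ) 1)
    (x : Fin M × Fin K → Bool) : 0 ≤ bernoulliWeight m x :=
  Finset.prod_nonneg fun p _ => by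
    have := hm p.1 p.2
    split_ifs
    · exact this.1
    · linarith [this.2]

lemma sum_prod_bool {ι : Type*} [Fintype ι] [DecidableEq ι] (f : ι → Bool → ℝ) :
    ∑ x : ι → Bool, ∏ p, f p (x p) = ∏ p, (f p true + f p false) := by
  have := Finset.prod_univ_sum (fun _ : ι => (Finset.univ : Finset Bool)) f
  rw [Fintype.piFinset_univ] at this
  rw [← this]
  simp

lemma sum_bernoulliWeight (m : Fin M → Fin K → ℝ) : ∑ x, bernoulliWeight m x = 1 := by
  have := sum_prod_bool fun (p : Fin M × Fin K) b => if b then m p.1 p.2 else 1 - m p.1 p.2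
  simpa [bernoulliWeight] using this

/-- The indicator only kills the `false` term of one factor, so the sum still factorizes. -/
lemma sum_bernoulliWeight_mul (m : Fin M → Fin K → ℝ) (c : Fin M) (a : Fin K) :
    ∑ x, bernoulliWeight m x * (if x (c, a) then 1 else 0) = m c a := by
  have : ∀ x : Fin M × Fin K → Bool, bernoulliWeight m x * (if x (c, a) then 1 else 0) =
      ∏ p, (if x p then m p.1 p.2 else if p = (c, a) then 0 else 1 - m p.1 p.2) := fun x => by
    unfold bernoulliWeight
    by_cases h : x (c, a) = true
    · rw [if_pos h, mul_one]
      refine Finset.prod_congr rfl fun p _ => ?_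
      by_cases hp : p = (c, a)
      · subst hp; simp [h]
      · simp [hp]
    · rw [if_neg h, mul_zero]
      exact (Finset.prod_eq_zero (Finset.mem_univ (c, a)) (by simp [h])).symm
  simp only [this]
  rw [sum_prod_bool fun p b => if b then m p.1 p.2 else if p = (c, a) then 0 else 1 - m p.1 p.2,
    Finset.prod_eq_single (c, a)]
  · simp
  · intro p _ hp; simp [hp]
  · simp

/-- The law of a table with independent Bernoulli entries with means `m`. -/
noncomputable def bernoulliMeasure (m : Fin M → Fin K → ℝ) : Measure (Table M K) :=
  ∑ x, ENNReal.ofReal (bernoulliWeight m x) • Measure.dirac (binaryTable x)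

/-- The law of a table with independent Bernoulli entries with means `m`. -/
noncomputable def bernoulliLaw (m : Fin M → Fin K → ℝ) (hm : ∀ c a, m c a ∈ Set.Icc (0 : ℝ) 1) :
    ProbabilityMeasure (Table M K) :=
  ⟨bernoulliMeasure m, ⟨by
    simp only [bernoulliMeasure, Measure.coe_finsetSum, Finset.sum_apply, Measure.smul_apply,
      measure_univ, smul_eq_mul, mul_one]
    rw [← ENNReal.ofReal_sum_of_nonneg fun x _ => bernoulliWeight_nonneg hm x,
      sum_bernoulliWeight, ENNReal.ofReal_one]⟩⟩

lemma mean_bernoulliLaw (m : Fin M → Fin K → ℝ) (hm : ∀ c a, m c a ∈ Set.Icc (0 : ℝ) 1)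
    (c : Fin M) (a : Fin K) : mean (bernoulliLaw m hm) c a = m c a := by
  have hmeas : Measurable fun r : Table M K => (r c a : ℝ) := by fun_prop
  have hint : ∀ μ : Measure (Table M K), IsFiniteMeasure μ →
      Integrable (fun r : Table M K => (r c a : ℝ)) μ := fun μ _ =>
    Integrable.of_bound hmeas.aestronglyMeasurable 1 (Filter.Eventually.of_forall fun r => by
      rw [Real.norm_of_nonneg (r c a).2.1]; exact (r c a).2.2)
  change ∫ r, (r c a : ℝ) ∂(bernoulliMeasure m) = m c a
  unfold bernoulliMeasure
  rw [integral_finsetSum_measure fun x _ => (hint _ inferInstance).smul_measure (by simp)]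
  rw [← sum_bernoulliWeight_mul m c a]
  refine Finset.sum_congr rfl fun x _ => ?_
  rw [integral_smul_measure, integral_dirac' _ _ hmeas.stronglyMeasurable,
    ENNReal.toReal_ofReal (bernoulliWeight_nonneg hm x), smul_eq_mul]
  unfold binaryTable
  split_ifs <;> simp

lemma lintegral_bernoulliMeasure (m : Fin M → Fin K → ℝ) {f : Table M K → ENNReal}
    (hf : Measurable f) : ∫⁻ r, f r ∂(bernoulliMeasure m) =
      ∑ x, ENNReal.ofReal (bernoulliWeight m x) * f (binaryTable x) := by
  unfold bernoulliMeasure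
  rw [lintegral_finsetSum_measure]
  refine Finset.sum_congr rfl fun x _ => ?_
  rw [lintegral_smul_measure, lintegral_dirac' _ hf, smul_eq_mul]

/-- Reflect one entry of a binary table. -/
def boolFlip (j : Fin M × Fin K) (x : Fin M × Fin K → Bool) : Fin M × Fin K → Bool :=
  fun p => if p = j then !(x p) else x p

lemma boolFlip_involutive (j : Fin M × Fin K) : Function.Involutive (boolFlip j) := fun x => by
  funext p
  unfold boolFlip
  split_ifs <;> simp

lemma flip_binaryTable (c₀ : Fin M) (a₀ : Fin K) (x : Fin M × Fin K → Bool) :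
    flip c₀ a₀ (binaryTable x) = binaryTable (boolFlip (c₀, a₀) x) := by
  funext c a
  unfold flip binaryTable boolFlip
  by_cases h : c = c₀ ∧ a = a₀
  · obtain ⟨rfl, rfl⟩ := h
    by_cases hx : x (c, a) = true <;> simp [hx]
  · rw [if_neg h, if_neg (fun e => h (Prod.ext_iff.1 e))]

/-- A fair entry is symmetric, and its two weights 1/2 become (1 ± δ)/2: the ratio is `tilt` at the
rewards 1 and 0. -/
lemma isTilt_bernoulliLaw {m m' : Fin M → Fin K → ℝ} (hm : ∀ c a, m c a ∈ Set.Icc (0 : ℝ) 1)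
    (hm' : ∀ c a, m' c a ∈ Set.Icc (0 : ℝ) 1) {δ : ℝ} {c₀ : Fin M} {a₀ : Fin K}
    (h0 : m c₀ a₀ = 1 / 2) (h1 : m' c₀ a₀ = (1 + δ) / 2)
    (h : ∀ c a, ¬ (c = c₀ ∧ a = a₀) → m' c a = m c a) :
    IsTilt (bernoulliLaw m hm) (bernoulliLaw m' hm') δ c₀ a₀ where
  symm := by
    change (bernoulliMeasure m).map _ = bernoulliMeasure m
    refine Measure.ext_of_lintegral _ fun f hf => ?_
    have hff : Measurable fun r => f (flip c₀ a₀ r) := hf.comp (measurable_flip c₀ a₀)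
    rw [lintegral_map hf (measurable_flip c₀ a₀), lintegral_bernoulliMeasure m hf,
      lintegral_bernoulliMeasure m hff,
      ← Equiv.sum_comp ((boolFlip_involutive (c₀, a₀)).toPerm)
        fun x => ENNReal.ofReal (bernoulliWeight m x) * f (binaryTable x)]
    refine Finset.sum_congr rfl fun x _ => ?_
    rw [flip_binaryTable, Function.Involutive.coe_toPerm]
    congr 2
    unfold bernoulliWeight
    refine Finset.prod_congr rfl fun p _ => ?_
    unfold boolFlip
    by_cases hp : p = (c₀, a₀)
    · subst hp
      by_cases hx : x (c₀, a₀) = true <;> simp [hx, h0] <;> norm_num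
    · simp [hp]
  density := by
    change bernoulliMeasure m' = (bernoulliMeasure m).withDensity _
    have ht := (measurable_tilt δ c₀ a₀).ennreal_ofReal
    refine Measure.ext_of_lintegral _ fun f hf => ?_
    rw [lintegral_withDensity_eq_lintegral_mul _ ht hf, lintegral_bernoulliMeasure m' hf,
      lintegral_bernoulliMeasure m (ht.mul hf)]
    refine Finset.sum_congr rfl fun x _ => ?_
    rw [Pi.mul_apply, ← mul_assoc, ← ENNReal.ofReal_mul (bernoulliWeight_nonneg hm x)]
    congr 2
    unfold bernoulliWeight
    rw [← Finset.mul_prod_erase _ _ (Finset.mem_univ (c₀, a₀)),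
      ← Finset.mul_prod_erase Finset.univ (fun p => if x p then m p.1 p.2 else 1 - m p.1 p.2)
        (Finset.mem_univ (c₀, a₀)), mul_right_comm]
    congr 1
    · unfold tilt binaryTable
      by_cases hx : x (c₀, a₀) = true <;> simp [hx, h0, h1] <;> ring
    · refine Finset.prod_congr rfl fun p hp => ?_
      rw [h p.1 p.2 fun hc => Finset.ne_of_mem_erase hp (Prod.ext hc.1 hc.2)]

/-! ### Averaging over instances -/

lemma sum_piFinset_update {ι α : Type*} [Fintype ι] [DecidableEq ι] [DecidableEq α]
    (A : ι → Finset α) (f : (ι → α) → ℝ) (i : ι) :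
    ∑ θ ∈ Fintype.piFinset A, ∑ a ∈ A i, f (Function.update θ i a) =
      (A i).card * ∑ θ ∈ Fintype.piFinset A, f θ := by
  rw [← Finset.sum_product']
  have h : ∑ x ∈ Fintype.piFinset A ×ˢ A i, f (Function.update x.1 i x.2) =
      ∑ x ∈ Fintype.piFinset A ×ˢ A i, f x.1 := by
    -- Swapping the new value with the old coordinate is an involution on pairs (θ, a).
    refine Finset.sum_nbij' (fun x => (Function.update x.1 i x.2, x.1 i))
      (fun x => (Function.update x.1 i x.2, x.1 i)) ?_ ?_ ?_ ?_ ?_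
    · rintro ⟨θ, a⟩ h
      simp only [Finset.mem_product, Fintype.mem_piFinset] at h ⊢
      refine ⟨fun j => ?_, h.1 i⟩
      by_cases hj : j = i
      · subst hj; simpa using h.2
      · simpa [hj] using h.1 j
    · rintro ⟨θ, a⟩ h
      simp only [Finset.mem_product, Fintype.mem_piFinset] at h ⊢
      refine ⟨fun j => ?_, h.1 i⟩
      by_cases hj : j = i
      · subst hj; simpa using h.2
      · simpa [hj] using h.1 j
    · rintro ⟨θ, a⟩ _; simp
    · rintro ⟨θ, a⟩ _; simp
    · rintro ⟨θ, a⟩ _; rfl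
  rw [h, Finset.sum_product, Finset.mul_sum]
  simp

/-- The worst instance is at least the average one, and in that average each coordinate may be
resampled separately. -/
lemma sum_le_of_sum_update_ge {ι α : Type*} [Fintype ι] [DecidableEq ι] [DecidableEq α]
    (A : ι → Finset α) (hA : ∀ i, (A i).Nonempty) (f : ι → (ι → α) → ℝ) (w : ι → ℝ) (R : ℝ)
    (h1 : ∀ θ ∈ Fintype.piFinset A, ∑ i, f i θ ≤ R)
    (h2 : ∀ i, ∀ θ ∈ Fintype.piFinset A,
      (A i).card * w i ≤ ∑ a ∈ A i, f i (Function.update θ i a)) :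
    ∑ i, w i ≤ R := by
  have hpos : (0 : ℝ) < (Fintype.piFinset A).card := by
    exact_mod_cast Finset.card_pos.2 (Fintype.piFinset_nonempty.2 hA)
  have h3 : ∀ i, (Fintype.piFinset A).card * w i ≤ ∑ θ ∈ Fintype.piFinset A, f i θ := fun i => by
    have hc : (0 : ℝ) < (A i).card := by exact_mod_cast Finset.card_pos.2 (hA i)
    have := Finset.sum_le_sum (h2 i)
    rw [sum_piFinset_update A (f i) i, Finset.sum_const, nsmul_eq_mul] at this
    refine le_of_mul_le_mul_left ?_ hc
    linarith
  have h4 : (Fintype.piFinset A).card * ∑ i, w i ≤ (Fintype.piFinset A).card * R := by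
    rw [Finset.mul_sum]
    calc _ ≤ ∑ i, ∑ θ ∈ Fintype.piFinset A, f i θ := Finset.sum_le_sum fun i _ => h3 i
      _ = ∑ θ ∈ Fintype.piFinset A, ∑ i, f i θ := Finset.sum_comm
      _ ≤ ∑ θ ∈ Fintype.piFinset A, R := Finset.sum_le_sum h1
      _ = _ := by simp
  exact le_of_mul_le_mul_left h4 hpos

/-! ### Hard instances -/

/-- The mean rewards of a hard instance: `θ c` is the best action under `c`, the safe action `u₀`
is second best or best, and the actions outside `S c` are much worse. -/
noncomputable def hardMean (u₀ : Fin K) (S : Fin M → Finset (Fin K)) (Δ : ℝ)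
    (θ : Fin M → Fin K) (c : Fin M) (b : Fin K) : ℝ :=
  if b = u₀ then 1 / 2 + Δ else if b ∈ S c then (if θ c = b then 1 / 2 + 2 * Δ else 1 / 2) else 0

lemma hardMean_mem (u₀ : Fin K) (S : Fin M → Finset (Fin K)) {Δ : ℝ} (h0 : 0 ≤ Δ)
    (h1 : Δ ≤ 1 / 4) (θ : Fin M → Fin K) (c : Fin M) (b : Fin K) :
    hardMean u₀ S Δ θ c b ∈ Set.Icc (0 : ℝ) 1 := by
  unfold hardMean
  split_ifs <;> constructor <;> linarith

/-- The gap of action `b` in a hard instance. -/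
noncomputable def hardGap (u₀ : Fin K) (S : Fin M → Finset (Fin K)) (Δ : ℝ)
    (θ : Fin M → Fin K) (c : Fin M) (b : Fin K) : ℝ :=
  (⨆ a, hardMean u₀ S Δ θ c a) - hardMean u₀ S Δ θ c b

section gap

variable (u₀ : Fin K) (S : Fin M → Finset (Fin K)) (Δ : ℝ) (θ : Fin M → Fin K) (c : Fin M)
  (b : Fin K)

lemma sub_le_hardGap (a : Fin K) :
    hardMean u₀ S Δ θ c a - hardMean u₀ S Δ θ c b ≤ hardGap u₀ S Δ θ c b :=
  sub_le_sub_right (le_ciSup (f := fun a => hardMean u₀ S Δ θ c a) (Set.finite_range _).bddAbove a)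
    _

lemma hardGap_nonneg : 0 ≤ hardGap u₀ S Δ θ c b := by
  simpa using sub_le_hardGap u₀ S Δ θ c b b

variable {u₀ S Δ θ c b}

lemma half_le_hardGap (hΔ : 0 ≤ Δ) (hb : b ∉ insert u₀ (S c)) :
    1 / 2 ≤ hardGap u₀ S Δ θ c b := by
  have := sub_le_hardGap u₀ S Δ θ c b u₀
  simp only [Finset.mem_insert, not_or] at hb
  simp only [hardMean, hb.1, hb.2, if_true, if_false] at this
  linarith

lemma le_hardGap_of_safe (hu₀ : u₀ ∉ S c) (hθ : θ c = u₀) (hb : b ∈ S c) :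
    Δ ≤ hardGap u₀ S Δ θ c b := by
  have := sub_le_hardGap u₀ S Δ θ c b u₀
  have hb' : b ≠ u₀ := fun h => hu₀ (h ▸ hb)
  simp only [hardMean, hb', hb, hθ, hb'.symm, if_true, if_false] at this
  linarith

lemma le_hardGap_of_ne (hΔ : 0 ≤ Δ) (hu₀ : u₀ ∉ S c) (hθ : θ c ∈ S c) (hb : b ≠ θ c) :
    Δ ≤ hardGap u₀ S Δ θ c b := by
  have := sub_le_hardGap u₀ S Δ θ c b (θ c)
  have hne : θ c ≠ u₀ := fun h => hu₀ (h ▸ hθ)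
  simp only [hardMean, hne, hθ, hb.symm, if_true, if_false] at this
  split_ifs at this <;> linarith

end gap

open Classical in
/-- Hard instances force regret, provided that the actions in the sets `S c` are rarely observed
without being played. -/
theorem hard_instance_bound (G : Digraph (Fin K)) (π : Policy M K) (u₀ : Fin K)
    (S : Fin M → Finset (Fin K)) (hu₀ : ∀ i, u₀ ∉ S i) (c : ℕ → Fin M) {N T : ℕ} (hNT : N ≤ T)
    (hS : ∀ t < N, (S (c t)).Nonempty) {Δ L R : ℝ} (hΔ0 : 0 ≤ Δ) (hΔ1 : (4 * Δ) ^ 2 ≤ 1 / 2)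
    (hobs : ∀ p : ℕ → Fin K → ℝ, (∀ t b, 0 ≤ p t b) → (∀ t, ∑ b, p t b = 1) → ∀ t < N,
      ∑ a ∈ S (c t), ∑ s ∈ Finset.range t, ∑ b, (if G.Adj b a then p s b else 0) ≤
        (S (c t)).card * (L + ∑ s ∈ Finset.range N, ∑ b,
          if b ∉ insert u₀ (S (c s)) then p s b else 0))
    (hR : ∀ P : ProbabilityMeasure (Table M K), regret G π P (fun t : Fin T => c t) ≤ R)
    (hX : 0 ≤ 4 / 5 - 4 * ((4 * Δ) ^ 2 * (L + 2 * R))) :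
    N * (Δ / 2 * (4 / 5 - 4 * ((4 * Δ) ^ 2 * (L + 2 * R)))) ≤ R := by
  have hΔ4 : Δ ≤ 1 / 4 := by nlinarith
  set X := 4 / 5 - 4 * ((4 * Δ) ^ 2 * (L + 2 * R)) with hXdef
  set P : (Fin M → Fin K) → ProbabilityMeasure (Table M K) := fun θ =>
    bernoulliLaw (hardMean u₀ S Δ θ) (hardMean_mem u₀ S hΔ0 hΔ4 θ) with hP
  set p : (Fin M → Fin K) → ℕ → Fin K → ℝ := fun θ => playProb G π (P θ) c with hp
  set g : (Fin M → Fin K) → Fin M → Fin K → ℝ := hardGap u₀ S Δ with hg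
  have hp0 : ∀ θ t b, 0 ≤ p θ t b := fun θ t b => playProb_nonneg _ _ _ _ _ _
  have hp1 : ∀ θ t, ∑ b, p θ t b = 1 := fun θ t => sum_playProb _ _ _ _ _
  have hg0 : ∀ θ i b, 0 ≤ g θ i b := fun θ i b => hardGap_nonneg _ _ _ _ _ _
  -- The gaps are nonnegative, so the rounds from `N` on can be dropped.
  have hreg : ∀ θ, ∑ t ∈ Finset.range N, ∑ b, p θ t b * g θ (c t) b ≤ R := fun θ => by
    refine le_trans ?_ (hR (P θ))
    rw [regret_eq]
    have e : ∀ i b, mean (P θ) i b = hardMean u₀ S Δ θ i b := fun i b => mean_bernoulliLaw _ _ i b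
    simp only [e]
    exact Finset.sum_le_sum_of_subset_of_nonneg (Finset.range_mono hNT) fun t _ _ =>
      Finset.sum_nonneg fun b _ => mul_nonneg (hp0 θ t b) (hg0 θ _ b)
  -- Each play outside `insert u₀ (S (c s))` costs at least 1/2.
  have hbad : ∀ θ, ∑ s ∈ Finset.range N, ∑ b,
      (if b ∉ insert u₀ (S (c s)) then p θ s b else 0) ≤ 2 * R := fun θ => by
    refine le_trans ?_ (mul_le_mul_of_nonneg_left (hreg θ) zero_le_two)
    rw [Finset.mul_sum]
    refine Finset.sum_le_sum fun s _ => ?_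
    rw [Finset.mul_sum]
    refine Finset.sum_le_sum fun b _ => ?_
    by_cases hb : b ∉ insert u₀ (S (c s))
    · rw [if_pos hb]
      have := half_le_hardGap (θ := θ) hΔ0 hb
      have := mul_le_mul_of_nonneg_left this (hp0 θ s b)
      linarith
    · rw [if_neg hb]
      have := mul_nonneg (hp0 θ s b) (hg0 θ (c s) b)
      linarith
  -- Raising `a` from 1/2 to 1/2 + 2Δ is a tilt by 4Δ of the instance in which `u₀` is best under
  -- `i`.
  have hinfo : ∀ θ i, ∀ a ∈ S i, ∀ t, p (Function.update θ i a) t a ≤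
      p (Function.update θ i u₀) t a + 1 / 5 + 4 * ((4 * Δ) ^ 2 * ∑ s ∈ Finset.range t, ∑ b,
        if G.Adj b a then p (Function.update θ i u₀) s b else 0) := fun θ i a ha t => by
    have hne : a ≠ u₀ := fun h => hu₀ i (h ▸ ha)
    refine playProb_le_of_isTilt G π (c₀ := i) (by positivity) hΔ1
      (isTilt_bernoulliLaw _ _ ?_ ?_ ?_) c t a
    · simp [hardMean, hne, hne.symm, ha]
    · simp [hardMean, hne, ha]; ring
    · intro j b hjb
      by_cases hj : j = i
      · subst hj
        have hb : b ≠ a := fun h => hjb ⟨rfl, h⟩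
        by_cases hb0 : b = u₀
        · simp [hardMean, hb0]
        · simp [hardMean, hb0, hb.symm, Ne.symm hb0]
      · simp [hardMean, hj]
  -- Playing `a` costs Δ if `u₀` is best, and not playing `a` costs Δ if `a` is best. As these two
  -- play probabilities are close on average over `S i`, the costs add up to about Δ per element of
  -- `S i`.
  have hround : ∀ θ, ∀ t < N, (S (c t)).card * (Δ * X) ≤
      ∑ a ∈ insert u₀ (S (c t)), ∑ b, p (Function.update θ (c t) a) t b *
        g (Function.update θ (c t) a) (c t) b := fun θ t ht => by
    set i := c t with hi
    rw [Finset.sum_insert (hu₀ i)]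
    have h1 : Δ * ∑ a ∈ S i, p (Function.update θ i u₀) t a ≤
        ∑ b, p (Function.update θ i u₀) t b * g (Function.update θ i u₀) i b := by
      rw [Finset.mul_sum]
      refine le_trans (Finset.sum_le_sum fun b hb => ?_) (Finset.sum_le_sum_of_subset_of_nonneg
        (Finset.subset_univ (S i)) fun b _ _ => mul_nonneg (hp0 _ t b) (hg0 _ i b))
      rw [mul_comm]
      exact mul_le_mul_of_nonneg_left (le_hardGap_of_safe (hu₀ i) (by simp) hb) (hp0 _ t b)
    have h2 : ∀ a ∈ S i, Δ * (1 - p (Function.update θ i a) t a) ≤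
        ∑ b, p (Function.update θ i a) t b * g (Function.update θ i a) i b := fun a ha => by
      rw [← hp1 (Function.update θ i a) t, ← Finset.add_sum_erase _ _ (Finset.mem_univ a),
        add_sub_cancel_left, Finset.mul_sum]
      refine le_trans (Finset.sum_le_sum fun b hb => ?_) (Finset.sum_le_sum_of_subset_of_nonneg
        (Finset.erase_subset a _) fun b _ _ => mul_nonneg (hp0 _ t b) (hg0 _ i b))
      rw [mul_comm]
      refine mul_le_mul_of_nonneg_left (le_hardGap_of_ne hΔ0 (hu₀ i) (by simpa using ha) ?_)
        (hp0 _ t b)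
      simpa using Finset.ne_of_mem_erase hb
    have h3 := Finset.sum_le_sum h2
    rw [← Finset.mul_sum] at h3
    have h4 := Finset.sum_le_sum fun a ha => hinfo θ i a ha t
    rw [Finset.sum_add_distrib, Finset.sum_add_distrib, ← Finset.mul_sum, ← Finset.mul_sum] at h4
    have h5 := hobs _ (hp0 (Function.update θ i u₀)) (hp1 _) t ht
    have h6 := hbad (Function.update θ i u₀)
    have h7 : ((S i).card : ℝ) * (L + ∑ s ∈ Finset.range N, ∑ b,
          if b ∉ insert u₀ (S (c s)) then p (Function.update θ i u₀) s b else 0) ≤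
        (S i).card * (L + 2 * R) :=
      mul_le_mul_of_nonneg_left (by linarith) (Nat.cast_nonneg _)
    have h8 := mul_le_mul_of_nonneg_left (h5.trans h7) (sq_nonneg (4 * Δ))
    simp only [Finset.sum_const, nsmul_eq_mul, Finset.sum_sub_distrib] at h3 h4
    have h9 : ((S i).card : ℝ) * X ≤ ∑ a ∈ S i, p (Function.update θ i u₀) t a +
        ((S i).card * 1 - ∑ a ∈ S i, p (Function.update θ i a) t a) := by
      rw [hXdef]; linarith
    have h10 := mul_le_mul_of_nonneg_left h9 hΔ0
    linarith
  have hfin := sum_le_of_sum_update_ge (fun i => insert u₀ (S i))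
    (fun i => Finset.insert_nonempty _ _)
    (fun i θ => ∑ t ∈ Finset.range N with c t = i, ∑ b, p θ t b * g θ i b)
    (fun i => ∑ t ∈ Finset.range N with c t = i, Δ / 2 * X) R
    (fun θ _ => by
      refine le_trans (le_of_eq ?_) (hreg θ)
      rw [← Finset.sum_fiberwise (Finset.range N) c]
      refine Finset.sum_congr rfl fun i _ => Finset.sum_congr rfl fun t ht => ?_
      rw [(Finset.mem_filter.1 ht).2])
    (fun i θ _ => by
      rw [Finset.sum_comm, Finset.mul_sum]
      refine Finset.sum_le_sum fun t ht => ?_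
      obtain ⟨htN, rfl⟩ := Finset.mem_filter.1 ht
      replace ht := Finset.mem_range.1 htN
      refine le_trans ?_ (hround θ t ht)
      -- The average runs over |S| + 1 ≤ 2 |S| choices of best action; hence Δ / 2.
      rw [Finset.card_insert_of_notMem (hu₀ _)]
      have h1 : (1 : ℝ) ≤ (S (c t)).card := by exact_mod_cast Finset.card_pos.2 (hS t ht)
      have h2 : 0 ≤ Δ * X := mul_nonneg hΔ0 hX
      push_cast
      nlinarith)
  rw [Finset.sum_fiberwise (Finset.range N) c] at hfin
  simpa using hfin

/-! ### Context sequences, and attainment of `beta` -/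

lemma exists_monotone_card_fiber (n : Fin M → ℕ) (hn : 0 < ∑ i, n i) :
    ∃ c : ℕ → Fin M, Monotone c ∧
      ∀ i, ((Finset.range (∑ i, n i)).filter (fun t => c t = i)).card = n i := by
  classical
  set N := ∑ i, n i with hN
  let e : (Σ i : Fin M, Fin (n i)) ≃ Fin N := finSigmaFinEquiv
  let f : Fin N → Fin M := fun t => (e.symm t).1
  have hmono : Monotone (f ∘ Tuple.sort f) := Tuple.monotone_sort f
  have hlt : ∀ t, min t (N - 1) < N := fun t => by omega
  -- The labels of the `N` slots are sorted; truncating at `N - 1` repeats the last context forever.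
  refine ⟨fun t => (f ∘ Tuple.sort f) ⟨min t (N - 1), hlt t⟩, fun s t hst => hmono ?_, fun i => ?_⟩
  · simp only [Fin.mk_le_mk]; omega
  · have h1 : ((Finset.range N).filter
        (fun t => (f ∘ Tuple.sort f) ⟨min t (N - 1), hlt t⟩ = i)).card =
        (Finset.univ.filter fun x : Σ i : Fin M, Fin (n i) => x.1 = i).card := by
      symm
      refine Finset.card_bij' (fun x _ => (((Tuple.sort f).symm (e x) : Fin N) : ℕ))
        (fun t _ => e.symm (Tuple.sort f ⟨min t (N - 1), hlt t⟩)) ?_ ?_ ?_ ?_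
      · intro x hx
        have hb := ((Tuple.sort f).symm (e x)).2
        have he : (⟨min (((Tuple.sort f).symm (e x) : Fin N) : ℕ) (N - 1), hlt _⟩ : Fin N) =
            (Tuple.sort f).symm (e x) := Fin.ext (by simp only; omega)
        simp only [Finset.mem_filter, Finset.mem_univ, true_and] at hx
        simp only [Finset.mem_filter, Finset.mem_range, hb, true_and, Function.comp_apply, he,
          Equiv.apply_symm_apply, f, Equiv.symm_apply_apply, hx]
      · intro t ht
        simpa [f] using (Finset.mem_filter.1 ht).2
      · intro x _
        have hb := ((Tuple.sort f).symm (e x)).2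
        have he : (⟨min (((Tuple.sort f).symm (e x) : Fin N) : ℕ) (N - 1), hlt _⟩ : Fin N) =
            (Tuple.sort f).symm (e x) := Fin.ext (by simp only; omega)
        simp [he]
      · intro t ht
        have := Finset.mem_range.1 (Finset.mem_filter.1 ht).1
        simp only [Equiv.apply_symm_apply, Equiv.symm_apply_apply]
        omega
    rw [h1, ← Fintype.card_subtype,
      Fintype.card_congr (Equiv.sigmaSubtype (β := fun i : Fin M => Fin (n i)) i), Fintype.card_fin]

lemma orderedBlocks_subset_selfAvoiding (M T : ℕ) : orderedBlocks M T ⊆ selfAvoiding M T := by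
  intro c hc s t _ hst i hsi hit
  exact le_antisymm ((hc hit).trans hst.ge) (hc hsi)

lemma minimaxRegret_mono (G : Digraph (Fin K)) {T : ℕ} {𝒞 𝒟 : Set (Fin T → Fin M)} (h : 𝒞 ⊆ 𝒟) :
    minimaxRegret G 𝒞 ≤ minimaxRegret G 𝒟 :=
  iInf_mono fun _ => biSup_mono fun _ hc => h hc

/-- The values of the weights whose maximum is `beta`. -/
def betaValues (G : Digraph (Fin K)) (M : ℕ) : Set ℕ :=
  {n : ℕ | ∃ I : Fin M → Finset (Fin K), (∀ c, IsIndependent G (I c)) ∧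
    (∀ i j, i < j → ∀ u ∈ I i, ∀ v ∈ I j, ¬ G.Adj u v) ∧ n = ∑ c, (I c).card}

lemma bddAbove_betaValues (G : Digraph (Fin K)) (M : ℕ) : BddAbove (betaValues G M) := by
  refine ⟨M * K, ?_⟩
  rintro n ⟨I, -, -, rfl⟩
  calc ∑ c, (I c).card ≤ ∑ _c : Fin M, K :=
        Finset.sum_le_sum fun c _ => (Finset.card_le_univ (I c)).trans (by simp)
    _ = M * K := by simp

lemma one_mem_betaValues (G : Digraph (Fin K)) (hK : 1 ≤ K) (hM : 1 ≤ M) :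
    1 ∈ betaValues G M := by
  refine ⟨fun i => if i = ⟨0, hM⟩ then {⟨0, hK⟩} else ∅, fun i u hu v hv huv => ?_,
    fun i j hij u hu v hv => ?_, ?_⟩
  · dsimp only at hu hv
    split_ifs at hu hv
    · rw [Finset.mem_singleton] at hu hv
      exact absurd (hu.trans hv.symm) huv
    · simp at hu
  · have : j ≠ ⟨0, hM⟩ := fun h => by
      subst h
      exact absurd (Fin.lt_def.1 hij) (Nat.not_lt_zero _)
    simp [this] at hv
  · simp [apply_ite Finset.card]

lemma one_le_beta (G : Digraph (Fin K)) (hK : 1 ≤ K) (hM : 1 ≤ M) : 1 ≤ beta G M :=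
  le_csSup (bddAbove_betaValues G M) (one_mem_betaValues G hK hM)

lemma beta_spec (G : Digraph (Fin K)) (hK : 1 ≤ K) (hM : 1 ≤ M) :
    ∃ I : Fin M → Finset (Fin K), (∀ c, IsIndependent G (I c)) ∧
      (∀ i j, i < j → ∀ u ∈ I i, ∀ v ∈ I j, ¬ G.Adj u v) ∧ beta G M = ∑ c, (I c).card :=
  Nat.sSup_mem ⟨1, one_mem_betaValues G hK hM⟩ (bddAbove_betaValues G M)

/-! ### Tuning the gap, and the cases β = 1 and β ≥ 2 -/

open Classical in
/-- The regret bound of hard instances with the tuned gap `1 / (16 √L)`. -/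
lemma le_worstRegret_of_family (G : Digraph (Fin K)) (π : Policy M K) (u₀ : Fin K)
    (S : Fin M → Finset (Fin K)) (hu₀ : ∀ i, u₀ ∉ S i) (c : ℕ → Fin M) (hc : Monotone c)
    {k L T β : ℕ} (hk : 1 ≤ k) (hL : k ^ 2 ≤ L) (hT : L * k ≤ T) (hT2 : T ≤ 2 * (L * k))
    (hβ : β ≤ 2 * k) (hS : ∀ t < L * k, (S (c t)).Nonempty)
    (hobs : ∀ p : ℕ → Fin K → ℝ, (∀ t b, 0 ≤ p t b) → (∀ t, ∑ b, p t b = 1) → ∀ t < L * k,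
      ∑ a ∈ S (c t), ∑ s ∈ Finset.range t, ∑ b, (if G.Adj b a then p s b else 0) ≤
        (S (c t)).card * (L + ∑ s ∈ Finset.range (L * k), ∑ b,
          if b ∉ insert u₀ (S (c s)) then p s b else 0)) :
    ((1 / 256 * √((β : ℝ) * (T : ℝ)) : ℝ) : EReal) ≤ worstRegret G π (orderedBlocks M T) := by
  by_contra! hlt
  set R : ℝ := 1 / 256 * √((β : ℝ) * (T : ℝ)) with hRdef
  have hR : ∀ P : ProbabilityMeasure (Table M K), regret G π P (fun t : Fin T => c t) ≤ R :=
    fun P => by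
      have h1 : ((regret G π P (fun t : Fin T => c t) : ℝ) : EReal) ≤
          worstRegret G π (orderedBlocks M T) :=
        le_iSup₂_of_le (fun t : Fin T => c t) (fun s t hst => hc hst)
          (le_iSup (fun P : ProbabilityMeasure (Table M K) =>
            ((regret G π P (fun t : Fin T => c t) : ℝ) : EReal)) P)
      exact_mod_cast (h1.trans_lt hlt).le
  set x := √(L : ℝ) with hx
  have hkR : (1 : ℝ) ≤ k := by exact_mod_cast hk
  have hLR : (k : ℝ) ^ 2 ≤ L := by exact_mod_cast hL
  have hxx : x * x = L := Real.mul_self_sqrt (Nat.cast_nonneg _)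
  have hkx : (k : ℝ) ≤ x := Real.le_sqrt_of_sq_le hLR
  have hx0 : 0 < x := by linarith
  -- This is half of the lower bound k √L / 64 reached at the end, which gives the contradiction.
  have hRle : R ≤ k * x / 128 := by
    have h1 : √((β : ℝ) * (T : ℝ)) ≤ 2 * k * x := by
      refine Real.sqrt_le_iff.2 ⟨by positivity, ?_⟩
      have hb : (β : ℝ) ≤ 2 * k := by exact_mod_cast hβ
      have ht : (T : ℝ) ≤ 2 * (L * k) := by exact_mod_cast hT2
      calc (β : ℝ) * T ≤ (2 * k) * (2 * (L * k)) := by gcongr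
        _ = (2 * k * x) ^ 2 := by rw [← hxx]; ring
    rw [hRdef]; linarith
  have hR0 : 0 ≤ R := by positivity
  set Δ := 1 / (16 * x) with hΔ
  have hΔ0 : 0 < Δ := by positivity
  have hΔx : Δ * x = 1 / 16 := by rw [hΔ]; field_simp
  have hΔ2 : (4 * Δ) ^ 2 * L = 1 / 16 := by
    calc (4 * Δ) ^ 2 * L = 16 * (Δ * x) ^ 2 := by rw [← hxx]; ring
      _ = 1 / 16 := by rw [hΔx]; norm_num
  -- Here k ≤ √L enters: observations bought by actions of mean 0 carry negligible information.
  have hΔR : (4 * Δ) ^ 2 * (2 * R) ≤ 1 / 1024 := by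
    calc (4 * Δ) ^ 2 * (2 * R) ≤ (4 * Δ) ^ 2 * (2 * (x * x / 128)) := by
          have : k * x / 128 ≤ x * x / 128 := by gcongr
          gcongr
          linarith
      _ = 1 / 4 * (Δ * x) ^ 2 := by ring
      _ ≤ 1 / 1024 := by rw [hΔx]; norm_num
  have hX : 1 / 2 ≤ 4 / 5 - 4 * ((4 * Δ) ^ 2 * (L + 2 * R)) := by
    rw [mul_add, hΔ2]; linarith
  have hmain := hard_instance_bound G π u₀ S hu₀ c hT hS hΔ0.le
    (by
      have : (4 * Δ) ^ 2 * 1 ≤ (4 * Δ) ^ 2 * L := by gcongr; nlinarith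
      linarith) hobs hR (by linarith)
  have h1 : ((L * k : ℕ) : ℝ) * (Δ / 2 * (1 / 2)) ≤ R := by
    refine le_trans ?_ hmain
    gcongr
  have h2 : ((L * k : ℕ) : ℝ) * (Δ / 2 * (1 / 2)) = k * x / 64 := by
    push_cast
    rw [← hxx]
    calc x * x * k * (Δ / 2 * (1 / 2)) = k * x * (Δ * x) / 4 := by ring
      _ = k * x / 64 := by rw [hΔx]; ring
  have : 0 < k * x := by positivity
  linarith

open Classical in
lemma sum_ite_le_one {p : Fin K → ℝ} (h0 : ∀ b, 0 ≤ p b) (h1 : ∑ b, p b = 1)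
    (q : Fin K → Prop) : ∑ b, (if q b then p b else 0) ≤ 1 := by
  rw [← h1]
  refine Finset.sum_le_sum fun b _ => ?_
  split_ifs
  · exact le_rfl
  · exact h0 b

theorem le_worstRegret_of_beta_eq_one (G : Digraph (Fin K)) (π : Policy M K) (hK : 2 ≤ K)
    (hM : 1 ≤ M) {T : ℕ} (hT : 1 ≤ T) :
    ((1 / 256 * √(((1 : ℕ) : ℝ) * (T : ℝ)) : ℝ) : EReal) ≤
      worstRegret G π (orderedBlocks M T) := by
  classical
  refine le_worstRegret_of_family G π (⟨0, by omega⟩ : Fin K) (fun _ => {(⟨1, by omega⟩ : Fin K)})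
    (fun _ => by simp [Fin.ext_iff]) (fun _ => ⟨0, hM⟩) monotone_const (k := 1) (L := T) le_rfl (by simpa)
    (by simp) (by omega) (by omega) (fun _ _ => by simp) fun p h0 h1 t ht => ?_
  rw [Finset.sum_singleton, Finset.card_singleton, Nat.cast_one, one_mul]
  have h2 : ∑ s ∈ Finset.range t, ∑ b, (if G.Adj b ⟨1, by omega⟩ then p s b else 0) ≤ (T : ℝ) := by
    calc _ ≤ ∑ s ∈ Finset.range t, (1 : ℝ) :=
          Finset.sum_le_sum fun s _ => sum_ite_le_one (h0 s) (h1 s) _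
      _ = t := by simp
      _ ≤ T := by exact_mod_cast (by omega : t ≤ T)
  refine h2.trans (le_add_of_nonneg_right ?_)
  refine Finset.sum_nonneg fun s _ => Finset.sum_nonneg fun b _ => ?_
  split_ifs
  · exact le_rfl
  · exact h0 s b

theorem le_worstRegret_of_two_le_beta (G : Digraph (Fin K)) (hG : ∀ a, G.Adj a a)
    (π : Policy M K) (I : Fin M → Finset (Fin K)) (hI : ∀ i, IsIndependent G (I i))
    (hIJ : ∀ i j, i < j → ∀ u ∈ I i, ∀ v ∈ I j, ¬ G.Adj u v) {β T : ℕ}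
    (hβ : β = ∑ i, (I i).card) (hβ2 : 2 ≤ β) (hT : β ^ 3 ≤ T) :
    ((1 / 256 * √((β : ℝ) * (T : ℝ)) : ℝ) : EReal) ≤ worstRegret G π (orderedBlocks M T) := by
  classical
  have hex : (Finset.univ.filter fun i => (I i).Nonempty).Nonempty := by
    by_contra h
    rw [Finset.not_nonempty_iff_eq_empty, Finset.filter_eq_empty_iff] at h
    have : β = 0 := by
      rw [hβ]
      exact Finset.sum_eq_zero fun i hi => by
        rw [Finset.card_eq_zero]; exact Finset.not_nonempty_iff_eq_empty.1 (h hi)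
    omega
  obtain ⟨i₀, hi₀, hmin⟩ : ∃ i₀, (I i₀).Nonempty ∧ ∀ i, (I i).Nonempty → i₀ ≤ i :=
    ⟨_, (Finset.mem_filter.1 (Finset.min'_mem _ hex)).2, fun i hi =>
      Finset.min'_le _ _ (Finset.mem_filter.2 ⟨Finset.mem_univ i, hi⟩)⟩
  obtain ⟨u₀, hu₀⟩ := hi₀
  set S : Fin M → Finset (Fin K) := fun i => (I i).erase u₀ with hS
  -- The self-loop at `u₀` forbids it from lying in two of the sets.
  have hu₀I : ∀ i, i ≠ i₀ → u₀ ∉ I i := fun i hi hu => by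
    rcases lt_or_gt_of_ne hi with h | h
    · exact hIJ i i₀ h u₀ hu u₀ hu₀ (hG u₀)
    · exact hIJ i₀ i h u₀ hu₀ u₀ hu (hG u₀)
  obtain ⟨k, rfl⟩ : ∃ k, β = k + 1 := ⟨β - 1, by omega⟩
  have hk : k = ∑ i, (S i).card := by
    have h1 : ∀ i, (I i).card = (S i).card + if i = i₀ then 1 else 0 := fun i => by
      by_cases hi : i = i₀
      · subst hi
        simp only [hS, if_true]
        exact (Finset.card_erase_add_one hu₀).symm
      · simp [hS, hi, Finset.erase_eq_of_notMem (hu₀I i hi)]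
    rw [Finset.sum_congr rfl fun i _ => h1 i, Finset.sum_add_distrib] at hβ
    simpa using hβ
  -- Since `i₀` is the first nonempty context, `u₀` counts as a member of an earlier or equal set;
  -- so neither `u₀` nor an earlier `S j` reveals anything about `S i`.
  have hadj : ∀ i j, j ≤ i → ∀ a ∈ S i, ∀ b ∈ insert u₀ (S j), G.Adj b a → j = i ∧ b = a := by
    intro i j hji a ha b hb hba
    obtain ⟨hau, haI⟩ := Finset.mem_erase.1 ha
    rcases Finset.mem_insert.1 hb with rfl | hb
    · rcases (hmin i ⟨a, haI⟩).eq_or_lt with h | h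
      · subst h; exact absurd hba (hI i₀ b hu₀ a haI hau.symm)
      · exact absurd hba (hIJ i₀ i h b hu₀ a haI)
    · have hbI := Finset.mem_of_mem_erase hb
      rcases hji.eq_or_lt with h | h
      · subst h
        exact ⟨rfl, by_contra fun hne => hI j b hbI a haI hne hba⟩
      · exact absurd hba (hIJ j i h b hbI a haI)
  have hk1 : 1 ≤ k := by omega
  set L := T / k with hLdef
  have hL : k ^ 2 ≤ L := by
    rw [hLdef, Nat.le_div_iff_mul_le (by omega)]
    calc k ^ 2 * k = k ^ 3 := by ring
      _ ≤ (k + 1) ^ 3 := Nat.pow_le_pow_left (by omega) 3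
      _ ≤ T := hT
  have hL1 : 1 ≤ L := le_trans (Nat.one_le_pow _ _ hk1) hL
  have hLk : ∑ i, L * (S i).card = L * k := by rw [← Finset.mul_sum, ← hk]
  obtain ⟨c, hc, hcard⟩ := exists_monotone_card_fiber (fun i => L * (S i).card)
    (by rw [hLk]; exact Nat.mul_pos hL1 hk1)
  rw [hLk] at hcard
  refine le_worstRegret_of_family G π u₀ S (fun i => Finset.notMem_erase _ _) c hc hk1 hL
    (Nat.div_mul_le_self T k) ?_ (by omega) ?_ ?_
  · have h1 := Nat.lt_mul_of_div_lt (Nat.lt_succ_self (T / k)) (by omega : 0 < k)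
    have h2 : k * 1 ≤ k * L := Nat.mul_le_mul_left k hL1
    rw [← hLdef] at h1
    nlinarith
  · intro t ht
    have h1 : t ∈ (Finset.range (L * k)).filter (fun s => c s = c t) := by simp [ht]
    have h2 := Finset.card_pos.2 ⟨t, h1⟩
    rw [hcard] at h2
    exact Finset.card_pos.1 (Nat.pos_of_mul_pos_left h2)
  · intro p h0 h1 t ht
    have hbad0 : ∀ s, 0 ≤ ∑ b, if b ∉ insert u₀ (S (c s)) then p s b else 0 := fun s =>
      Finset.sum_nonneg fun b _ => by
        split_ifs
        · exact le_rfl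
        · exact h0 s b
    -- An action of mean 0 may reveal all of `S (c t)` at once, hence the factor |S|. Every other
    -- observation of `a` is a play of `a` under the current context, and such plays total at most
    -- one per round.
    have hround : ∀ s ∈ Finset.range t,
        ∑ a ∈ S (c t), ∑ b, (if G.Adj b a then p s b else 0) ≤
          (S (c t)).card * (∑ b, if b ∉ insert u₀ (S (c s)) then p s b else 0) +
            if c s = c t then 1 else 0 := fun s hs => by
      have hst : c s ≤ c t := hc (Finset.mem_range.1 hs).le
      have h2 : ∀ a ∈ S (c t), ∑ b, (if G.Adj b a then p s b else 0) ≤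
          (∑ b, if b ∉ insert u₀ (S (c s)) then p s b else 0) +
            if c s = c t then p s a else 0 := fun a ha => by
        have h3 : (if c s = c t then p s a else 0) =
            ∑ b, if b = a then (if c s = c t then p s b else 0) else 0 := by simp
        rw [h3, ← Finset.sum_add_distrib]
        refine Finset.sum_le_sum fun b _ => ?_
        have hp := h0 s b
        by_cases hba : G.Adj b a
        · by_cases hb : b ∈ insert u₀ (S (c s))
          · obtain ⟨h4, rfl⟩ := hadj _ _ hst a ha b hb hba
            rw [if_pos hba, if_neg (not_not.2 hb), if_pos rfl, if_pos h4, zero_add]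
          · simp only [hba, hb, if_true, not_false_eq_true]
            split_ifs <;> linarith
        · rw [if_neg hba]
          split_ifs <;> linarith
      refine (Finset.sum_le_sum h2).trans ?_
      rw [Finset.sum_add_distrib, Finset.sum_const, nsmul_eq_mul]
      refine add_le_add le_rfl ?_
      split_ifs
      · rw [← h1 s]
        exact Finset.sum_le_sum_of_subset_of_nonneg (Finset.subset_univ _) fun b _ _ => h0 s b
      · simp
    have hsub : Finset.range t ⊆ Finset.range (L * k) := Finset.range_mono ht.le
    rw [Finset.sum_comm]
    refine (Finset.sum_le_sum hround).trans ?_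
    rw [Finset.sum_add_distrib, ← Finset.mul_sum, mul_add, add_comm]
    refine add_le_add ?_ (mul_le_mul_of_nonneg_left
      (Finset.sum_le_sum_of_subset_of_nonneg hsub fun s _ _ => hbad0 s) (Nat.cast_nonneg _))
    -- The block of context `c t` has L |S (c t)| rounds: L observations per action on average.
    refine (Finset.sum_le_sum_of_subset_of_nonneg hsub fun s _ _ => ?_).trans (le_of_eq ?_)
    · split_ifs
      · exact zero_le_one
      · exact le_rfl
    · rw [Finset.sum_boole, hcard]
      push_cast
      ring

end GraphBandit

theorem theorem1 :
    ∃ C : ℝ, 0 < C ∧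
      ∀ (K M T : ℕ), 2 ≤ K → 1 ≤ M →
        ∀ G : Digraph (Fin K), (∀ a, G.Adj a a) →
          (GraphBandit.beta G M) ^ 3 ≤ T →
            ((C * √((GraphBandit.beta G M : ℝ) * (T : ℝ)) : ℝ) : EReal) ≤
                GraphBandit.minimaxRegret G (Set.univ : Set (Fin T → Fin M)) ∧
            ((C * √((GraphBandit.beta G M : ℝ) * (T : ℝ)) : ℝ) : EReal) ≤
                GraphBandit.minimaxRegret G (GraphBandit.selfAvoiding M T) ∧
            ((C * √((GraphBandit.beta G M : ℝ) * (T : ℝ)) : ℝ) : EReal) ≤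
                GraphBandit.minimaxRegret G (GraphBandit.orderedBlocks M T) := by
  refine ⟨1 / 256, by norm_num, fun K M T hK hM G hG hT => ?_⟩
  have key : ((1 / 256 * √((GraphBandit.beta G M : ℝ) * (T : ℝ)) : ℝ) : EReal) ≤
      GraphBandit.minimaxRegret G (GraphBandit.orderedBlocks M T) := by
    refine le_iInf fun π => ?_
    have hpos := GraphBandit.one_le_beta G (by omega : 1 ≤ K) hM
    obtain ⟨I, hI, hIJ, hβ⟩ := GraphBandit.beta_spec G (by omega : 1 ≤ K) hM
    rcases hpos.eq_or_lt with h1 | h2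
    · rw [← h1] at hT ⊢
      exact GraphBandit.le_worstRegret_of_beta_eq_one G π hK hM (by simpa using hT)
    · exact GraphBandit.le_worstRegret_of_two_le_beta G hG π I hI hIJ hβ h2 hT
  exact ⟨key.trans (GraphBandit.minimaxRegret_mono G (Set.subset_univ _)),
    key.trans (GraphBandit.minimaxRegret_mono G
      (GraphBandit.orderedBlocks_subset_selfAvoiding M T)), key⟩
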